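/- Theorem. A CSS code on $n$ qubits is given by binary parity-check matrices $H_X\in\mathbb F_2^{n_X\times n}$ and $H_Z\in\mathbb F_2^{n_Z\times n}$ with $H_XH_Z^T=0$, whose rows are the $X$-type and $Z$-type stabilizer generators; equivalently, by a chain complex $C_{k+1}=\mathbb F_2^{n_Z}\to C_k=\mathbb F_2^{n}\to C_{k-1}=\mathbb F_2^{n_X}$ with $\partial_{k+1}=H_Z^T$, $\partial_k=H_X$, and $\delta^{k-1}=H_X^T$. Its distance $d$ is the minimal weight of a nontrivial logical Pauli operator ($d=\infty$ if there is none), and a code state is a unit vector fixed by all stabilizer generators. Consider a family of CSS codes that is quantum LDPC: all stabilizer generators of all codes have weight at most a constant $s$. Below, $O(1)$, $\omega(1)$ and $O(m)$ refer to the limit of the number $n$ of physical qubits tending to infinity along the family, and $|\cdot|$ is the Hamming weight. Suppose that $d=\omega(1)$ and that the family has (a) weak systolic expansion: for every choice of chains $f\in C_{k+1}$ (one for each code), if $\min_{z\in\ker\partial_{k+1}}|f+z|=\omega(1)$, then $|\partial_{k+1}f|=\omega(1)$; (b) weak cosystolic expansion: for every choice of cochains $f\in C^{k-1}=\mathbb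 F_2^{n_X}$ (one for each code), if $\min_{z\in\ker\delta^{k-1}}|f+z|=\omega(1)$, then $|\delta^{k-1}f|=\omega(1)$. Let $K=O(1)$. Then for every $K$-local Hamiltonian $\hat H=\sum_{j=1}^m\hat H_j$ on the $n$ qubits, meaning that each $\hat H_j$ is Hermitian with $\|\hat H_j\|\le 1$ and acts nontrivially on at most $K$ qubits, and that each qubit is acted on nontrivially by at most $K$ of the terms $\hat H_j$, and for every code state $|\psi\rangle$, the quantum Fisher information satisfies $$\mathcal F(|\psi\rangle,\hat H)=\langle\psi|\hat H^2|\psi\rangle-|\langle\psi|\hat H|\psi\rangle|^2=O(m),$$ where the implied constant depends only on the family of codes and on $K$, not on $\hat H$, $m$ or $|\psi\rangle$. -/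

import Mathlib

open Filter Matrix

/-! ## Qubits, Pauli operators, supports

The computational basis of `n` qubits is indexed by bit strings `Fin n → ZMod 2`. -/

/-- Bit strings of length `n`, which are also the `𝔽₂`-chains on `n` cells. -/
abbrev Bits (n : ℕ) : Type := Fin n → ZMod 2

/-- State vectors of `n` qubits. -/
abbrev QState (n : ℕ) : Type := EuclideanSpace ℂ (Bits n)

/-- Operators on `n` qubits, as matrices in the computational basis. -/
abbrev QOp (n : ℕ) : Type := Matrix (Bits n) (Bits n) ℂ

/-- The operator of a matrix, acting on the Hilbert space of `n` qubits. -/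
noncomputable def QOp.toCLM {n : ℕ} (O : QOp n) : QState n →L[ℂ] QState n :=
  Matrix.toEuclideanCLM (𝕜 := ℂ) O

/-- The Pauli operator `X^a`, which maps the basis vector `|y⟩` to `|y + a⟩`. -/
def pauliX {n : ℕ} (a : Bits n) : QOp n :=
  Matrix.of fun x y => if x = y + a then 1 else 0

/-- The Pauli operator `Z^b`, which maps the basis vector `|x⟩` to `(-1)^(b·x) |x⟩`. -/
def pauliZ {n : ℕ} (b : Bits n) : QOp n :=
  Matrix.diagonal fun x => (-1) ^ (b ⬝ᵥ x).val

/-- `O = O_A ⊗ 𝕀` for some operator `O_A` on the qubits in `A`. -/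
def QOp.IsSupportedOn {n : ℕ} (O : QOp n) (A : Finset (Fin n)) : Prop :=
  ∃ OA : Matrix (A → ZMod 2) (A → ZMod 2) ℂ, ∀ x y : Bits n,
    ((∀ i, i ∉ A → x i = y i) → O x y = OA (fun i => x i) (fun i => y i)) ∧
    ((∃ i, i ∉ A ∧ x i ≠ y i) → O x y = 0)

open Classical in
/-- The support of `O`: the qubits on which `O` acts nontrivially, that is, those qubits `i`
for which `O` is not of the form `O' ⊗ 𝕀` with `𝕀` on qubit `i`. -/
noncomputable def QOp.supp {n : ℕ} (O : QOp n) : Finset (Fin n) :=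
  Finset.univ.filter fun i => ¬ O.IsSupportedOn (Finset.univ.erase i)

/-! ## Local Hamiltonians and quantum Fisher information -/

/-- A `K`-local Hamiltonian `∑_{j=1}^m H_j` on `n` qubits: each term is Hermitian of operator
norm at most `1`, acts on at most `K` qubits, and each qubit is acted on by at most `K` of the
terms (counted with multiplicity). -/
structure LocalHamiltonian (n m K : ℕ) where
  /-- the terms `H_j` -/
  term : Fin m → QOp n
  isHermitian : ∀ j, (term j).IsHermitian
  norm_le_one : ∀ j, ‖(term j).toCLM‖ ≤ 1
  card_supp_le : ∀ j, (term j).supp.card ≤ K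
  degree_le : ∀ i : Fin n, {j : Fin m | i ∈ (term j).supp}.ncard ≤ K

/-- The Hamiltonian `H = ∑_j H_j` itself. -/
noncomputable def LocalHamiltonian.total {n m K : ℕ} (H : LocalHamiltonian n m K) : QOp n :=
  ∑ j, H.term j

/-- The quantum Fisher information of a pure state `ψ` for the evolution `exp (-i θ H / 2)`:
`⟨ψ|H²|ψ⟩ - |⟨ψ|H|ψ⟩|²`. -/
noncomputable def qfi {n : ℕ} (ψ : QState n) (H : QOp n) : ℝ :=
  (inner ℂ ψ (QOp.toCLM (H * H) ψ)).re - ‖inner ℂ ψ (H.toCLM ψ)‖ ^ 2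

/-! ## CSS codes -/

/-- A CSS code given by its parity-check matrices; the rows of `hX` are the `X`-type stabilizer
generators and the rows of `hZ` are the `Z`-type ones. Equivalently, a chain complex
`C_{k+1} → C_k → C_{k-1}` over `𝔽₂` with `Z`-checks, qubits and `X`-checks as its cells, boundary
maps `∂_{k+1} = hZᵀ` and `∂_k = hX`, and coboundary map `δ^{k-1} = hXᵀ`. -/
structure CSSCode where
  /-- number of physical qubits -/
  n : ℕ
  /-- number of `X`-type generators -/
  nX : ℕ
  /-- number of `Z`-type generators -/
  nZ : ℕ
  hX : Matrix (Fin nX) (Fin n) (ZMod 2)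
  hZ : Matrix (Fin nZ) (Fin n) (ZMod 2)
  comm : hX * hZᵀ = 0

namespace CSSCode

/-- All stabilizer generators have weight at most `s`. -/
def IsLDPC (C : CSSCode) (s : ℕ) : Prop :=
  (∀ j, hammingNorm (C.hX j) ≤ s) ∧ (∀ j, hammingNorm (C.hZ j) ≤ s)

/-- A code state: a unit vector fixed by all stabilizer generators. -/
def IsCodeState (C : CSSCode) (ψ : QState C.n) : Prop :=
  ‖ψ‖ = 1 ∧ (∀ j, (pauliX (C.hX j)).toCLM ψ = ψ) ∧ (∀ j, (pauliZ (C.hZ j)).toCLM ψ = ψ)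

/-- `X^a Z^b` is a nontrivial logical operator: it commutes with all stabilizer generators, and
it is not, up to a phase, a product of stabilizer generators. -/
def IsNontrivialLogical (C : CSSCode) (a b : Bits C.n) : Prop :=
  C.hZ *ᵥ a = 0 ∧ C.hX *ᵥ b = 0 ∧
    ¬ ((∃ u, a = C.hXᵀ *ᵥ u) ∧ (∃ v, b = C.hZᵀ *ᵥ v))

/-- The code distance: the minimal weight (number of qubits acted on) of a nontrivial logical
Pauli operator; it is `⊤` if there is none (no encoded qubit). -/
noncomputable def distance (C : CSSCode) : ℕ∞ :=
  ⨅ (a : Bits C.n) (b : Bits C.n) (_ : C.IsNontrivialLogical a b),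
    ((Finset.univ.filter fun i => a i ≠ 0 ∨ b i ≠ 0).card : ℕ∞)

end CSSCode

/-! ## Asymptotics and weak expansion -/

/-- The limit `n → ∞` along a family of codes, `n` being the number of physical qubits.
A quantity `g` is `ω(1)` with respect to `n` if it tends to infinity along this filter. -/
def manyQubits {ι : Type*} (𝒞 : ι → CSSCode) : Filter ι :=
  Filter.comap (fun i => (𝒞 i).n) atTop

/-- `min_{z ∈ ker M} |f + z|`, with `|·|` the Hamming weight. -/
noncomputable def minCosetWeight {a b : ℕ} (M : Matrix (Fin a) (Fin b) (ZMod 2)) (f : Bits b) :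
    ℕ :=
  sInf {w | ∃ z : Bits b, M *ᵥ z = 0 ∧ hammingNorm (f + z) = w}

/-- Weak systolic expansion: for chains `f ∈ C_{k+1}`, whenever `min_{z ∈ Z_{k+1}} |f + z|` is
`ω(1)`, so is `|∂_{k+1} f|`. -/
def WeakSystolicExpansion {ι : Type*} (𝒞 : ι → CSSCode) : Prop :=
  ∀ f : (i : ι) → Bits (𝒞 i).nZ,
    Tendsto (fun i => minCosetWeight (𝒞 i).hZᵀ (f i)) (manyQubits 𝒞) atTop →
    Tendsto (fun i => hammingNorm ((𝒞 i).hZᵀ *ᵥ f i)) (manyQubits 𝒞) atTop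

/-- Weak cosystolic expansion: for cochains `f ∈ C^{k-1}`, whenever `min_{z ∈ Z^{k-1}} |f + z|`
is `ω(1)`, so is `|δ^{k-1} f|`. -/
def WeakCosystolicExpansion {ι : Type*} (𝒞 : ι → CSSCode) : Prop :=
  ∀ f : (i : ι) → Bits (𝒞 i).nX,
    Tendsto (fun i => minCosetWeight (𝒞 i).hXᵀ (f i)) (manyQubits 𝒞) atTop →
    Tendsto (fun i => hammingNorm ((𝒞 i).hXᵀ *ᵥ f i)) (manyQubits 𝒞) atTop

/-! A Pauli operator `P = X^a Z^b` on fewer qubits than the distance either commutes with all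
stabilizer generators, and then it is itself a product of generators and fixes every code state `ψ`,
or it anticommutes with a generator `g`. In the second case `Pψ` lies in the `-1` eigenspace of `g`,
while `Oψ` lies in the `+1` eigenspace for every `O` acting away from `g`, so that `P` and `O` are
uncorrelated in `ψ`.

The detectable errors on a set `A` of qubits are all detected by at most `|A|` checks of each
type, namely rows of the parity-check matrices whose restrictions to `A` span the restrictions of
all rows. By Pauli expansion, each term of a local Hamiltonian is therefore uncorrelated with
every term that avoids the boundedly many qubits of these checks; only boundedly many terms
remain, each of covariance at most `1`. -/

section Signs

theorem eq_zero_or_eq_one_of_zmod_two (t : ZMod 2) : t = 0 ∨ t = 1 := by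
  decide +revert

variable {R : Type*} [Ring R]

theorem neg_one_pow_val_add (s t : ZMod 2) :
    (-1 : R) ^ (s + t).val = (-1) ^ s.val * (-1) ^ t.val := by
  rw [← pow_add, ZMod.val_add, neg_one_pow_eq_pow_mod_two (n := s.val + t.val)]

theorem neg_one_pow_val_of_ne_zero {t : ZMod 2} (ht : t ≠ 0) : (-1 : R) ^ t.val = -1 := by
  rw [(eq_zero_or_eq_one_of_zmod_two t).resolve_left ht, ZMod.val_one, pow_one]

end Signs

theorem sum_eq_zero_of_add_right_eq_neg {G R : Type*} [Fintype G] [AddGroup G] [AddCommGroup R]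
    [IsAddTorsionFree R] {f : G → R} (e : G) (h : ∀ x, f (x + e) = -f x) : ∑ x, f x = 0 := by
  refine self_eq_neg.1 ?_
  calc ∑ x, f x = ∑ x, f (x + e) := (Fintype.sum_equiv (Equiv.addRight e) _ _ fun _ => rfl).symm
    _ = -∑ x, f x := by simp only [h, Finset.sum_neg_distrib]

theorem inner_eq_zero_of_apply_eq_neg_of_apply_eq {𝕜 E : Type*} [RCLike 𝕜]
    [NormedAddCommGroup E] [InnerProductSpace 𝕜 E] {g : E →ₗ[𝕜] E} (hg : g.IsSymmetric) {u v : E}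
    (hu : g u = -u) (hv : g v = v) : inner 𝕜 u v = 0 := by
  have h := hg u v
  rw [hu, hv, inner_neg_left] at h
  exact self_eq_neg.1 h.symm

theorem norm_sub_inner_smul_le {𝕜 E : Type*} [RCLike 𝕜] [NormedAddCommGroup E]
    [InnerProductSpace 𝕜 E] {u : E} (hu : ‖u‖ = 1) (v : E) : ‖v - inner 𝕜 u v • u‖ ≤ ‖v‖ := by
  rw [← Submodule.starProjection_unit_singleton 𝕜 hu, ← Submodule.starProjection_orthogonal_val]
  exact Submodule.norm_starProjection_apply_le _ v

section Rows

variable {F ρ κ : Type*} [Fintype κ]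

theorem dotProduct_eq_zero_of_forall_notMem [NonUnitalNonAssocSemiring F] {A : Finset κ}
    {v w : κ → F} (hv : ∀ i ∉ A, v i = 0) (hw : ∀ i ∈ A, w i = 0) : v ⬝ᵥ w = 0 := by
  refine Finset.sum_eq_zero fun i _ => ?_
  by_cases hi : i ∈ A
  · rw [hw i hi, mul_zero]
  · rw [hv i hi, zero_mul]

theorem mulVec_apply_eq_sum_coe [NonUnitalNonAssocSemiring F] (M : Matrix ρ κ F) {A : Finset κ}
    {v : κ → F} (hv : ∀ i ∉ A, v i = 0) (j : ρ) : (M *ᵥ v) j = ∑ i : A, M j i * v i := by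
  rw [Finset.sum_coe_sort A fun i => M j i * v i]
  refine (Finset.sum_subset A.subset_univ fun i _ hi => ?_).symm
  rw [hv i hi, mul_zero]

theorem exists_card_le_and_forall_mulVec_eq_zero [DivisionRing F] (M : Matrix ρ κ F)
    (A : Finset κ) :
    ∃ R : Finset ρ, R.card ≤ A.card ∧
      ∀ v : κ → F, (∀ i ∉ A, v i = 0) → (∀ j ∈ R, (M *ᵥ v) j = 0) → M *ᵥ v = 0 := by
  obtain ⟨σ, r, hr, hspan, hli⟩ := exists_linearIndependent' F fun j (i : A) => M j i
  have : Finite σ := hli.finite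
  have : Fintype σ := Fintype.ofFinite σ
  refine ⟨Finset.univ.map ⟨r, hr⟩, ?_, fun v hv hR => ?_⟩
  · rw [Finset.card_map, Finset.card_univ, ← Fintype.card_coe A,
      ← Module.finrank_fintype_fun_eq_card F (η := A)]
    exact hli.fintype_card_le_finrank
  · have hvanish : ∀ w ∈ Submodule.span F (Set.range fun j (i : A) => M j i),
        ∑ i, w i * v i = 0 := by
      intro w hw
      rw [← hspan] at hw
      induction hw using Submodule.span_induction with
      | mem w hw =>
        obtain ⟨k, rfl⟩ := hw
        exact (mulVec_apply_eq_sum_coe M hv (r k)).symm.trans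
          (hR _ (Finset.mem_map_of_mem _ (Finset.mem_univ k)))
      | zero => simp
      | add w₁ w₂ _ _ h₁ h₂ =>
        simp only [Pi.add_apply, add_mul, Finset.sum_add_distrib, h₁, h₂, add_zero]
      | smul c w _ h =>
        simp only [Pi.smul_apply, smul_eq_mul, mul_assoc, ← Finset.mul_sum, h, mul_zero]
    funext j
    rw [mulVec_apply_eq_sum_coe M hv j]
    exact hvanish _ (Submodule.subset_span ⟨j, rfl⟩)

theorem exists_finset_forall_mulVec_ne_zero [DivisionRing F] [DecidableEq F] {s : ℕ}
    (M : Matrix ρ κ F) (hM : ∀ j, hammingNorm (M j) ≤ s) (A : Finset κ) :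
    ∃ T : Finset κ, T.card ≤ A.card * s ∧
      ∀ v : κ → F, (∀ i ∉ A, v i = 0) → M *ᵥ v ≠ 0 →
        ∃ j, (∀ i ∉ T, M j i = 0) ∧ (M *ᵥ v) j ≠ 0 := by
  classical
  obtain ⟨R, hcard, hR⟩ := exists_card_le_and_forall_mulVec_eq_zero M A
  refine ⟨R.biUnion fun j => {i | M j i ≠ 0}, ?_, fun v hv hne => ?_⟩
  · exact (Finset.card_biUnion_le_card_mul _ _ s fun j _ => hM j).trans
      (Nat.mul_le_mul_right s hcard)
  · obtain ⟨j, hj, hjv⟩ : ∃ j ∈ R, (M *ᵥ v) j ≠ 0 := by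
      by_contra! h
      exact hne (hR v hv h)
    refine ⟨j, fun i hi => ?_, hjv⟩
    by_contra hji
    exact hi (Finset.mem_biUnion.2 ⟨j, hj, by simpa using hji⟩)

end Rows

theorem transpose_mulVec_induction {ρ κ : Type*} [Fintype ρ] {p : (κ → ZMod 2) → Prop} (h0 : p 0)
    (hadd : ∀ v w, p v → p w → p (v + w)) (M : Matrix ρ κ (ZMod 2)) (hM : ∀ j, p (M j))
    (u : ρ → ZMod 2) : p (Mᵀ *ᵥ u) := by
  rw [mulVec_transpose, vecMul_eq_sum]
  refine Finset.sum_induction _ p hadd h0 fun j _ => ?_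
  obtain hu | hu := eq_zero_or_eq_one_of_zmod_two (u j)
  · simpa only [hu, zero_smul] using h0
  · simpa only [hu, one_smul] using hM j

namespace Bits

variable {n : ℕ}

theorem add_self (a : Bits n) : a + a = 0 :=
  funext fun i => CharTwo.add_self_eq_zero (a i)

theorem eq_add_iff_eq_add (x y a : Bits n) : x = y + a ↔ y = x + a := by
  constructor <;> rintro rfl <;> rw [add_assoc, add_self, add_zero]

theorem eq_add_iff_add_eq (x y a : Bits n) : x = y + a ↔ x + y = a := by
  constructor <;> rintro rfl
  · rw [add_right_comm, add_self, zero_add]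
  · rw [add_left_comm, add_self, add_zero]

theorem add_eq_zero_iff (x y : Bits n) : x + y = 0 ↔ x = y := by
  rw [← eq_add_iff_add_eq, add_zero]

theorem sum_neg_one_pow_dotProduct (w : Bits n) :
    ∑ b : Bits n, (-1 : ℂ) ^ (b ⬝ᵥ w).val = if w = 0 then 2 ^ n else 0 := by
  split_ifs with h
  · simp [h, ZMod.card]
  · obtain ⟨i, hi⟩ := Function.ne_iff.1 h
    refine sum_eq_zero_of_add_right_eq_neg (Pi.single i 1) fun b => ?_
    rw [add_dotProduct, single_one_dotProduct, neg_one_pow_val_add,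
      neg_one_pow_val_of_ne_zero hi, mul_neg_one]

end Bits

namespace QOp

variable {n : ℕ}

section Pauli

theorem pauliX_mul_apply (a : Bits n) (O : QOp n) (x y : Bits n) :
    (pauliX a * O) x y = O (x + a) y := by
  simp [pauliX, Matrix.mul_apply, Bits.eq_add_iff_eq_add x]

theorem pauliX_zero : pauliX (0 : Bits n) = 1 := by
  ext x y
  simp [pauliX, Matrix.one_apply]

theorem pauliZ_zero : pauliZ (0 : Bits n) = 1 := by
  simp [pauliZ]

theorem pauliX_add (a a' : Bits n) : pauliX (a + a') = pauliX a * pauliX a' := by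
  ext x y
  rw [pauliX_mul_apply]
  simp only [pauliX, Matrix.of_apply]
  refine if_congr ?_ rfl rfl
  rw [Bits.eq_add_iff_eq_add x, Bits.eq_add_iff_eq_add (x + a), add_assoc]

theorem pauliZ_add (b b' : Bits n) : pauliZ (b + b') = pauliZ b * pauliZ b' := by
  simp [pauliZ, add_dotProduct, neg_one_pow_val_add]

theorem commute_pauliX_pauliX (a a' : Bits n) : Commute (pauliX a) (pauliX a') := by
  rw [Commute, SemiconjBy, ← pauliX_add, add_comm, pauliX_add]

theorem commute_pauliZ_pauliZ (b b' : Bits n) : Commute (pauliZ b) (pauliZ b') := by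
  rw [Commute, SemiconjBy, ← pauliZ_add, add_comm, pauliZ_add]

theorem isHermitian_pauliX (a : Bits n) : (pauliX a).IsHermitian := by
  ext x y
  simp only [pauliX, Matrix.conjTranspose_apply, Matrix.of_apply, apply_ite star, star_one,
    star_zero]
  exact if_congr (Bits.eq_add_iff_eq_add y x a) rfl rfl

theorem isHermitian_pauliZ (b : Bits n) : (pauliZ b).IsHermitian := by
  refine Matrix.isHermitian_diagonal_of_self_adjoint _ ?_
  funext x
  simp

theorem pauliZ_mul_pauliX (a b : Bits n) :
    pauliZ b * pauliX a = (-1 : ℂ) ^ (b ⬝ᵥ a).val • (pauliX a * pauliZ b) := by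
  ext x y
  rw [Matrix.smul_apply, pauliX_mul_apply]
  by_cases h : x = y + a
  · simp [pauliX, pauliZ, h, dotProduct_add, neg_one_pow_val_add, mul_comm, add_assoc,
      Bits.add_self]
  · have h' : x + a ≠ y := fun hxy => h (by rw [← hxy, add_assoc, Bits.add_self, add_zero])
    simp [pauliX, pauliZ, h, h']

/-- The Pauli operator `X^a Z^b`. The phase that would make it Hermitian when it acts as `XZ` on
some qubits is omitted. -/
def pauli (a b : Bits n) : QOp n := pauliX a * pauliZ b

theorem pauli_apply (a b x y : Bits n) :
    pauli a b x y = if x = y + a then (-1) ^ (b ⬝ᵥ y).val else 0 := by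
  simp [pauli, pauliX, pauliZ]

theorem pauliX_mul_pauli (e a b : Bits n) :
    pauliX e * pauli a b = (-1 : ℂ) ^ (b ⬝ᵥ e).val • (pauli a b * pauliX e) := by
  rw [pauli, mul_assoc, pauliZ_mul_pauliX, mul_smul_comm, smul_smul, ← mul_pow, neg_one_mul,
    neg_neg, one_pow, one_smul, ← mul_assoc, ← mul_assoc, (commute_pauliX_pauliX e a).eq]

theorem pauliZ_mul_pauli (e a b : Bits n) :
    pauliZ e * pauli a b = (-1 : ℂ) ^ (e ⬝ᵥ a).val • (pauli a b * pauliZ e) := by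
  rw [pauli, ← mul_assoc, pauliZ_mul_pauliX, smul_mul_assoc, mul_assoc, mul_assoc,
    (commute_pauliZ_pauliZ e b).eq]

end Pauli

section Support

variable {O : QOp n} {i : Fin n}

theorem apply_eq_zero_of_notMem_supp (hi : i ∉ O.supp) {x y : Bits n} (h : x i ≠ y i) :
    O x y = 0 := by
  obtain ⟨OA, hO⟩ : O.IsSupportedOn (Finset.univ.erase i) := by simpa [supp] using hi
  exact (hO x y).2 ⟨i, by simp, h⟩

theorem apply_add_single_of_notMem_supp (hi : i ∉ O.supp) (t : ZMod 2) (x y : Bits n) :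
    O (x + Pi.single i t) (y + Pi.single i t) = O x y := by
  by_cases h : x i = y i
  · obtain ⟨OA, hO⟩ : O.IsSupportedOn (Finset.univ.erase i) := by simpa [supp] using hi
    rw [(hO x y).1 (by simpa using h), (hO _ _).1 (by simpa using h)]
    congr 1 <;>
    · funext j
      simp [Finset.ne_of_mem_erase j.2]
  · rw [apply_eq_zero_of_notMem_supp hi h, apply_eq_zero_of_notMem_supp hi (by simpa using h)]

end Support

section PauliExpansion

/-- The coefficient of `X^a Z^b` in the expansion of `O` in Pauli operators, that is, the normalized
Hilbert-Schmidt inner product of `X^a Z^b` and `O`. -/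
noncomputable def pauliCoeff (O : QOp n) (a b : Bits n) : ℂ :=
  (2 ^ n)⁻¹ * ∑ z, (-1) ^ (b ⬝ᵥ z).val * O (z + a) z

theorem sum_pauliCoeff_mul_neg_one_pow (O : QOp n) (a y : Bits n) :
    ∑ b, pauliCoeff O a b * (-1) ^ (b ⬝ᵥ y).val = O (y + a) y := by
  calc ∑ b, pauliCoeff O a b * (-1) ^ (b ⬝ᵥ y).val
    _ = (2 ^ n)⁻¹ * ∑ z, (∑ b, (-1) ^ (b ⬝ᵥ (z + y)).val) * O (z + a) z := by
      simp only [pauliCoeff, Finset.mul_sum, Finset.sum_mul, dotProduct_add, neg_one_pow_val_add]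
      rw [Finset.sum_comm]
      exact Finset.sum_congr rfl fun _ _ => Finset.sum_congr rfl fun _ _ => by ring
    _ = (2 ^ n)⁻¹ * ∑ z, if z = y then 2 ^ n * O (z + a) z else 0 := by
      simp only [Bits.sum_neg_one_pow_dotProduct, Bits.add_eq_zero_iff, ite_mul, zero_mul]
    _ = O (y + a) y := by
      simp

theorem sum_pauliCoeff_smul_pauli (O : QOp n) : ∑ a, ∑ b, pauliCoeff O a b • pauli a b = O := by
  ext x y
  simp only [Matrix.sum_apply, Matrix.smul_apply, pauli_apply, smul_eq_mul, mul_ite, mul_zero,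
    Finset.sum_ite_irrel, Finset.sum_const_zero, sum_pauliCoeff_mul_neg_one_pow,
    Bits.eq_add_iff_add_eq x y, Finset.sum_ite_eq, Finset.mem_univ, if_true]
  rw [add_left_comm, Bits.add_self, add_zero]

variable {O : QOp n} {i : Fin n}

theorem pauliCoeff_eq_zero_of_left_ne_zero (hi : i ∉ O.supp) {a : Bits n} (ha : a i ≠ 0)
    (b : Bits n) : pauliCoeff O a b = 0 := by
  refine mul_eq_zero_of_right _ (Finset.sum_eq_zero fun z _ => ?_)
  rw [apply_eq_zero_of_notMem_supp hi (by simpa using ha), mul_zero]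

theorem pauliCoeff_eq_zero_of_right_ne_zero (hi : i ∉ O.supp) (a : Bits n) {b : Bits n}
    (hb : b i ≠ 0) : pauliCoeff O a b = 0 := by
  refine mul_eq_zero_of_right _ (sum_eq_zero_of_add_right_eq_neg (Pi.single i 1) fun z => ?_)
  rw [dotProduct_add, dotProduct_single_one, neg_one_pow_val_add, neg_one_pow_val_of_ne_zero hb,
    add_right_comm, apply_add_single_of_notMem_supp hi, mul_neg_one, neg_mul]

/-- The Pauli operators on a set `A` of qubits. -/
def paulisOn (A : Finset (Fin n)) : Set (QOp n) :=
  {P | ∃ a b : Bits n, (∀ i ∉ A, a i = 0) ∧ (∀ i ∉ A, b i = 0) ∧ pauli a b = P}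

theorem mem_span_paulisOn {A : Finset (Fin n)} (hA : O.supp ⊆ A) :
    O ∈ Submodule.span ℂ (paulisOn A) := by
  rw [← sum_pauliCoeff_smul_pauli O]
  refine Submodule.sum_mem _ fun a _ => Submodule.sum_mem _ fun b _ => ?_
  by_cases ha : ∀ i ∉ A, a i = 0
  · by_cases hb : ∀ i ∉ A, b i = 0
    · exact Submodule.smul_mem _ _ (Submodule.subset_span ⟨a, b, ha, hb, rfl⟩)
    · push Not at hb
      obtain ⟨i, hi, hbi⟩ := hb
      simp [pauliCoeff_eq_zero_of_right_ne_zero (fun h => hi (hA h)) a hbi]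
  · push Not at ha
    obtain ⟨i, hi, hai⟩ := ha
    simp [pauliCoeff_eq_zero_of_left_ne_zero (fun h => hi (hA h)) hai b]

theorem commute_of_forall_mem_paulisOn {g : QOp n} (h : ∀ P ∈ paulisOn O.supp, Commute g P) :
    Commute g O :=
  Algebra.commute_of_mem_adjoin_of_forall_mem_commute
    (Algebra.span_le_adjoin ℂ _ (mem_span_paulisOn subset_rfl)) h

theorem commute_pauliX_of_forall_mem_supp {e : Bits n} (he : ∀ i ∈ O.supp, e i = 0) :
    Commute (pauliX e) O := by
  refine commute_of_forall_mem_paulisOn ?_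
  rintro _ ⟨a, b, -, hb, rfl⟩
  rw [Commute, SemiconjBy, pauliX_mul_pauli, dotProduct_eq_zero_of_forall_notMem hb he,
    ZMod.val_zero, pow_zero, one_smul]

theorem commute_pauliZ_of_forall_mem_supp {e : Bits n} (he : ∀ i ∈ O.supp, e i = 0) :
    Commute (pauliZ e) O := by
  refine commute_of_forall_mem_paulisOn ?_
  rintro _ ⟨a, b, ha, -, rfl⟩
  rw [Commute, SemiconjBy, pauliZ_mul_pauli, dotProduct_comm,
    dotProduct_eq_zero_of_forall_notMem ha he, ZMod.val_zero, pow_zero, one_smul]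

end PauliExpansion

section Covariance

theorem toCLM_mul_apply (O P : QOp n) (ψ : QState n) :
    QOp.toCLM (O * P) ψ = O.toCLM (P.toCLM ψ) := by
  simp [toCLM]

theorem toCLM_one_apply (ψ : QState n) : (1 : QOp n).toCLM ψ = ψ := by
  simp [toCLM]

theorem toCLM_neg_apply (O : QOp n) (ψ : QState n) : (-O).toCLM ψ = -O.toCLM ψ := by
  simp [toCLM]

theorem toCLM_add_apply (O P : QOp n) (ψ : QState n) :
    (O + P).toCLM ψ = O.toCLM ψ + P.toCLM ψ := by
  simp [toCLM]

theorem toCLM_smul_apply (c : ℂ) (O : QOp n) (ψ : QState n) : (c • O).toCLM ψ = c • O.toCLM ψ := by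
  simp [toCLM]

theorem isSymmetric_toCLM {O : QOp n} (hO : O.IsHermitian) :
    O.toCLM.toLinearMap.IsSymmetric := by
  rwa [toCLM, Matrix.coe_toEuclideanCLM_eq_toEuclideanLin, Matrix.isSymmetric_toEuclideanLin_iff]

/-- The covariance `⟨P†O⟩ - ⟨P†⟩⟨O⟩` of two operators in the state `ψ`, which measures how much a
pair of terms contributes to the quantum Fisher information. It is bundled as a sesquilinear map so
that the first operator can be expanded in Pauli operators. -/
noncomputable def covariance (ψ : QState n) : QOp n →ₗ⋆[ℂ] QOp n →ₗ[ℂ] ℂ :=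
  LinearMap.mk₂'ₛₗ _ _
    (fun P O => inner ℂ (P.toCLM ψ) (O.toCLM ψ) - inner ℂ (P.toCLM ψ) ψ * inner ℂ ψ (O.toCLM ψ))
    (fun P Q O => by simp only [toCLM_add_apply, inner_add_left]; ring)
    (fun c P O => by simp only [toCLM_smul_apply, inner_smul_left, smul_eq_mul]; ring)
    (fun P O Q => by simp only [toCLM_add_apply, inner_add_right]; ring)
    (fun c P O => by
      simp only [toCLM_smul_apply, inner_smul_right, smul_eq_mul, RingHom.id_apply]
      ring)

theorem covariance_apply (ψ : QState n) (P O : QOp n) :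
    covariance ψ P O =
      inner ℂ (P.toCLM ψ) (O.toCLM ψ) - inner ℂ (P.toCLM ψ) ψ * inner ℂ ψ (O.toCLM ψ) :=
  rfl

theorem re_covariance_self {O : QOp n} (hO : O.IsHermitian) (ψ : QState n) :
    (covariance ψ O O).re = qfi ψ O := by
  have hsymm : inner ℂ (O.toCLM ψ) (O.toCLM ψ) = inner ℂ ψ (O.toCLM (O.toCLM ψ)) :=
    isSymmetric_toCLM hO ψ (O.toCLM ψ)
  rw [covariance_apply, qfi, toCLM_mul_apply, Complex.sub_re, hsymm,
    ← inner_conj_symm (O.toCLM ψ) ψ, Complex.conj_mul']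
  norm_cast

variable {ψ : QState n} {P O : QOp n}

theorem norm_covariance_le (hψ : ‖ψ‖ = 1) :
    ‖covariance ψ P O‖ ≤ ‖P.toCLM ψ‖ * ‖O.toCLM ψ‖ := by
  calc ‖covariance ψ P O‖
    _ = ‖inner ℂ (P.toCLM ψ) (O.toCLM ψ - inner ℂ ψ (O.toCLM ψ) • ψ)‖ := by
      rw [covariance_apply, inner_sub_right, inner_smul_right, mul_comm (inner ℂ ψ _)]
    _ ≤ ‖P.toCLM ψ‖ * ‖O.toCLM ψ - inner ℂ ψ (O.toCLM ψ) • ψ‖ := norm_inner_le_norm _ _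
    _ ≤ ‖P.toCLM ψ‖ * ‖O.toCLM ψ‖ := by
      gcongr
      exact norm_sub_inner_smul_le hψ _

theorem covariance_eq_zero_of_apply_eq_self (hψ : ‖ψ‖ = 1) (hP : P.toCLM ψ = ψ) :
    covariance ψ P O = 0 := by
  rw [covariance_apply, hP, inner_self_eq_norm_sq_to_K, hψ]
  simp

theorem covariance_eq_zero_of_anticommute {g : QOp n} (hg : g.IsHermitian) (hψ : g.toCLM ψ = ψ)
    (hP : g * P = -(P * g)) (hO : Commute g O) : covariance ψ P O = 0 := by
  have hgP : g.toCLM (P.toCLM ψ) = -P.toCLM ψ := by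
    rw [← toCLM_mul_apply, hP, toCLM_neg_apply, toCLM_mul_apply, hψ]
  have hgO : g.toCLM (O.toCLM ψ) = O.toCLM ψ := by
    rw [← toCLM_mul_apply, hO.eq, toCLM_mul_apply, hψ]
  have horth : ∀ {v}, g.toCLM v = v → inner ℂ (P.toCLM ψ) v = 0 :=
    inner_eq_zero_of_apply_eq_neg_of_apply_eq (isSymmetric_toCLM hg) hgP
  rw [covariance_apply, horth hgO, horth hψ, zero_mul, sub_zero]

end Covariance

end QOp

namespace CSSCode

open QOp

variable {C : CSSCode} {ψ : QState C.n} {A : Finset (Fin C.n)}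

theorem IsCodeState.pauliX_apply (hψ : C.IsCodeState ψ) (u : Bits C.nX) :
    (pauliX (C.hXᵀ *ᵥ u)).toCLM ψ = ψ :=
  transpose_mulVec_induction (p := fun a => (pauliX a).toCLM ψ = ψ)
    (by rw [pauliX_zero, toCLM_one_apply])
    (fun a b ha hb => by rw [pauliX_add, toCLM_mul_apply, hb, ha]) C.hX hψ.2.1 u

theorem IsCodeState.pauliZ_apply (hψ : C.IsCodeState ψ) (v : Bits C.nZ) :
    (pauliZ (C.hZᵀ *ᵥ v)).toCLM ψ = ψ :=
  transpose_mulVec_induction (p := fun b => (pauliZ b).toCLM ψ = ψ)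
    (by rw [pauliZ_zero, toCLM_one_apply])
    (fun a b ha hb => by rw [pauliZ_add, toCLM_mul_apply, hb, ha]) C.hZ hψ.2.2 v

theorem not_isNontrivialLogical_of_card_lt_distance (hA : (A.card : ℕ∞) < C.distance)
    {a b : Bits C.n} (ha : ∀ i ∉ A, a i = 0) (hb : ∀ i ∉ A, b i = 0) :
    ¬ C.IsNontrivialLogical a b := by
  intro h
  have hle : C.distance ≤ ((Finset.univ.filter fun i => a i ≠ 0 ∨ b i ≠ 0).card : ℕ∞) :=
    iInf_le_of_le a (iInf_le_of_le b (iInf_le_of_le h le_rfl))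
  refine (hA.trans_le hle).not_ge (Nat.cast_le.2 (Finset.card_le_card fun i hi => ?_))
  by_contra hiA
  simp [ha i hiA, hb i hiA] at hi

theorem IsCodeState.pauli_apply (hψ : C.IsCodeState ψ) {a b : Bits C.n} (ha : C.hZ *ᵥ a = 0)
    (hb : C.hX *ᵥ b = 0) (h : ¬ C.IsNontrivialLogical a b) : (pauli a b).toCLM ψ = ψ := by
  obtain ⟨⟨u, rfl⟩, ⟨v, rfl⟩⟩ : (∃ u, a = C.hXᵀ *ᵥ u) ∧ ∃ v, b = C.hZᵀ *ᵥ v := by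
    by_contra hst
    exact h ⟨ha, hb, hst⟩
  rw [pauli, toCLM_mul_apply, hψ.pauliZ_apply, hψ.pauliX_apply]

theorem IsCodeState.covariance_pauli_eq_zero_of_hZ (hψ : C.IsCodeState ψ) {a : Bits C.n}
    (b : Bits C.n) {l : Fin C.nZ} (hl : C.hZ l ⬝ᵥ a ≠ 0) {O : QOp C.n}
    (hO : ∀ i ∈ O.supp, C.hZ l i = 0) : covariance ψ (pauli a b) O = 0 := by
  refine covariance_eq_zero_of_anticommute (isHermitian_pauliZ _) (hψ.2.2 l) ?_
    (commute_pauliZ_of_forall_mem_supp hO)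
  rw [pauliZ_mul_pauli, neg_one_pow_val_of_ne_zero hl, neg_one_smul]

theorem IsCodeState.covariance_pauli_eq_zero_of_hX (hψ : C.IsCodeState ψ) (a : Bits C.n)
    {b : Bits C.n} {l : Fin C.nX} (hl : C.hX l ⬝ᵥ b ≠ 0) {O : QOp C.n}
    (hO : ∀ i ∈ O.supp, C.hX l i = 0) : covariance ψ (pauli a b) O = 0 := by
  refine covariance_eq_zero_of_anticommute (isHermitian_pauliX _) (hψ.2.1 l) ?_
    (commute_pauliX_of_forall_mem_supp hO)
  rw [pauliX_mul_pauli, dotProduct_comm, neg_one_pow_val_of_ne_zero hl, neg_one_smul]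

theorem IsCodeState.exists_finset_covariance_eq_zero (hψ : C.IsCodeState ψ) {s : ℕ}
    (hC : C.IsLDPC s) (hA : (A.card : ℕ∞) < C.distance) :
    ∃ T : Finset (Fin C.n), T.card ≤ 2 * A.card * s ∧
      ∀ P O : QOp C.n, P.supp ⊆ A → Disjoint O.supp T → covariance ψ P O = 0 := by
  obtain ⟨TX, hTX, hX⟩ := exists_finset_forall_mulVec_ne_zero C.hX hC.1 A
  obtain ⟨TZ, hTZ, hZ⟩ := exists_finset_forall_mulVec_ne_zero C.hZ hC.2 A
  refine ⟨TX ∪ TZ, ?_, fun P O hP hO => ?_⟩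
  · linarith [Finset.card_union_le TX TZ]
  obtain ⟨hOX, hOZ⟩ := Finset.disjoint_union_right.1 hO
  suffices h : Submodule.span ℂ (paulisOn A) ≤ LinearMap.ker ((covariance ψ).flip O) from
    h (mem_span_paulisOn hP)
  rw [Submodule.span_le]
  rintro _ ⟨a, b, ha, hb, rfl⟩
  change covariance ψ (pauli a b) O = 0
  by_cases hZa : C.hZ *ᵥ a = 0
  · by_cases hXb : C.hX *ᵥ b = 0
    · exact covariance_eq_zero_of_apply_eq_self hψ.1
        (hψ.pauli_apply hZa hXb (not_isNontrivialLogical_of_card_lt_distance hA ha hb))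
    · obtain ⟨l, hlT, hl⟩ := hX b hb hXb
      exact hψ.covariance_pauli_eq_zero_of_hX a hl
        fun i hi => hlT i (Finset.disjoint_left.1 hOX hi)
  · obtain ⟨l, hlT, hl⟩ := hZ a ha hZa
    exact hψ.covariance_pauli_eq_zero_of_hZ b hl
      fun i hi => hlT i (Finset.disjoint_left.1 hOZ hi)

end CSSCode

namespace LocalHamiltonian

open QOp

variable {n m K : ℕ} (H : LocalHamiltonian n m K)

theorem isHermitian_total : H.total.IsHermitian := by
  rw [Matrix.IsHermitian, total, Matrix.conjTranspose_sum]
  exact Finset.sum_congr rfl fun j _ => (H.isHermitian j).eq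

open Classical in
theorem card_filter_not_disjoint_le (T : Finset (Fin n)) :
    (Finset.univ.filter fun k => ¬ Disjoint (H.term k).supp T).card ≤ T.card * K := by
  have hsub : (Finset.univ.filter fun k => ¬ Disjoint (H.term k).supp T) ⊆
      T.biUnion fun i => Finset.univ.filter fun k => i ∈ (H.term k).supp := by
    intro k hk
    obtain ⟨i, hi, hiT⟩ := Finset.not_disjoint_iff.1 (Finset.mem_filter.1 hk).2
    exact Finset.mem_biUnion.2 ⟨i, hiT, by simpa using hi⟩
  refine (Finset.card_le_card hsub).trans (Finset.card_biUnion_le_card_mul _ _ K fun i _ => ?_)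
  have hdeg := H.degree_le i
  rwa [Set.ncard_eq_toFinset_card', Set.toFinset_ofPred] at hdeg

theorem qfi_total (ψ : QState n) :
    qfi ψ H.total = ∑ j, ∑ k, (covariance ψ (H.term j) (H.term k)).re := by
  rw [← re_covariance_self H.isHermitian_total, total]
  simp only [map_sum, LinearMap.sum_apply, Complex.re_sum]
  exact Finset.sum_comm

variable {H} {ψ : QState n}

theorem re_covariance_le_one (hψ : ‖ψ‖ = 1) (j k : Fin m) :
    (covariance ψ (H.term j) (H.term k)).re ≤ 1 := by
  have hnorm : ∀ l, ‖(H.term l).toCLM ψ‖ ≤ 1 := fun l => by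
    simpa [hψ] using (H.term l).toCLM.le_of_opNorm_le (H.norm_le_one l) ψ
  exact (Complex.re_le_norm _).trans
    ((norm_covariance_le hψ).trans (mul_le_one₀ (hnorm j) (norm_nonneg _) (hnorm k)))

theorem sum_re_covariance_le (hψ : ‖ψ‖ = 1) {j : Fin m} {T : Finset (Fin n)}
    (hT : ∀ O : QOp n, Disjoint O.supp T → covariance ψ (H.term j) O = 0) :
    ∑ k, (covariance ψ (H.term j) (H.term k)).re ≤ (T.card * K : ℕ) := by
  classical
  calc ∑ k, (covariance ψ (H.term j) (H.term k)).re
    _ = ∑ k with ¬ Disjoint (H.term k).supp T, (covariance ψ (H.term j) (H.term k)).re := by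
      refine (Finset.sum_filter_of_ne fun k _ hne => mt (fun hd => ?_) hne).symm
      rw [hT _ hd, Complex.zero_re]
    _ ≤ (Finset.univ.filter fun k => ¬ Disjoint (H.term k).supp T).card • (1 : ℝ) :=
      Finset.sum_le_card_nsmul _ _ _ fun k _ => re_covariance_le_one hψ j k
    _ ≤ (T.card * K : ℕ) := by
      rw [nsmul_one]
      exact_mod_cast H.card_filter_not_disjoint_le T

end LocalHamiltonian

theorem theorem3_general {C : CSSCode} {s m K : ℕ} (hC : C.IsLDPC s)
    (hK : (K : ℕ∞) < C.distance) (H : LocalHamiltonian C.n m K) {ψ : QState C.n}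
    (hψ : C.IsCodeState ψ) : qfi ψ H.total ≤ (2 * s * K ^ 2 : ℕ) * m := by
  have hrow : ∀ j, ∑ k, (QOp.covariance ψ (H.term j) (H.term k)).re ≤ (2 * s * K ^ 2 : ℕ) := by
    intro j
    have hj : ((H.term j).supp.card : ℕ∞) < C.distance :=
      (Nat.cast_le.2 (H.card_supp_le j)).trans_lt hK
    obtain ⟨T, hT, hcov⟩ := hψ.exists_finset_covariance_eq_zero hC hj
    refine (H.sum_re_covariance_le hψ.1 fun O => hcov _ O subset_rfl).trans (Nat.cast_le.2 ?_)
    calc T.card * K ≤ 2 * (H.term j).supp.card * s * K := by gcongr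
      _ ≤ 2 * K * s * K := by gcongr; exact H.card_supp_le j
      _ = 2 * s * K ^ 2 := by ring
  calc qfi ψ H.total = ∑ j, ∑ k, (QOp.covariance ψ (H.term j) (H.term k)).re := H.qfi_total ψ
    _ ≤ ∑ _j : Fin m, ((2 * s * K ^ 2 : ℕ) : ℝ) := Finset.sum_le_sum fun j _ => hrow j
    _ = (2 * s * K ^ 2 : ℕ) * m := by simp [mul_comm]

theorem theorem3 {ι : Type*} (𝒞 : ι → CSSCode) (s : ℕ)
    (hLDPC : ∀ i, (𝒞 i).IsLDPC s)
    (hdist : ∀ D : ℕ, ∀ᶠ i in manyQubits 𝒞, (D : ℕ∞) ≤ (𝒞 i).distance)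
    (hsys : WeakSystolicExpansion 𝒞)
    (hcosys : WeakCosystolicExpansion 𝒞)
    (K : ℕ) :
    ∃ C : ℝ, ∀ᶠ i in manyQubits 𝒞,
      ∀ (m : ℕ) (H : LocalHamiltonian (𝒞 i).n m K) (ψ : QState (𝒞 i).n),
        (𝒞 i).IsCodeState ψ → qfi ψ H.total ≤ C * m := by
  refine ⟨(2 * s * K ^ 2 : ℕ), (hdist (K + 1)).mono fun i hi m H ψ hψ => ?_⟩
  exact theorem3_general (hLDPC i) ((Nat.cast_lt.2 K.lt_succ_self).trans_le hi) H hψ
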